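/- For every real number $\alpha$, $$\Bigl(\frac{\pi^2}{9}\Bigr)^{\alpha}=1+\sum_{n=1}^{\infty}(-1)^n\sum_{j=1}^{n}(-1)^j\,\frac{\langle\alpha\rangle_j}{j!}\sum_{\ell=1}^{j}(-1)^{\ell}\,(2\ell)!\binom{j}{\ell}\frac{Q(2\ell,2n)}{(2\ell+2n)!},$$ where the series over $n$ converges absolutely. Here $\langle\alpha\rangle_j=\prod_{i=0}^{j-1}(\alpha-i)$ is the falling factorial and, for integers $k\ge 1$ and $m\ge 2$, $$Q(k,m)=\sum_{\ell=0}^{m}\binom{k+\ell-1}{k-1}\,s(k+m-1,k+\ell-1)\Bigl(\frac{k+m-2}{2}\Bigr)^{\ell},$$ where $s(n,k)$ are the (signed) Stirling numbers of the first kind, determined by $\dfrac{[\ln(1+x)]^k}{k!}=\sum_{n=k}^{\infty}s(n,k)\dfrac{x^n}{n!}$ for $|x|<1$. -/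

import Mathlib

noncomputable section

/-- The signed Stirling number of the first kind `s(n, k)`: the coefficient of `x ^ k` in the
falling factorial `x (x - 1) ⋯ (x - n + 1)`, and `n! / k!` times the coefficient of `x ^ n` in
`(log (1 + x)) ^ k`. Mathlib's `Nat.stirlingFirst` is the unsigned number `|s(n, k)|`. -/
def signedStirlingFirst (n k : ℕ) : ℤ :=
  (-1) ^ (n - k) * (Nat.stirlingFirst n k : ℤ)

/-- The falling factorial `⟨β⟩_n = β (β - 1) ⋯ (β - n + 1)` of a real number `β`. -/
def fallingFactorial (β : ℝ) (n : ℕ) : ℝ :=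
  ∏ k ∈ Finset.range n, (β - (k : ℝ))

/-- `Q(k, m) = ∑_{ℓ=0}^{m} C(k+ℓ-1, k-1) s(k+m-1, k+ℓ-1) ((k+m-2)/2)^ℓ`,
meant for `k ≥ 1` and `m ≥ 2` (only then are the natural-number subtractions the true ones). -/
def stirlingQ (k m : ℕ) : ℝ :=
  ∑ ℓ ∈ Finset.range (m + 1),
    (Nat.choose (k + ℓ - 1) (k - 1) : ℝ) *
      (signedStirlingFirst (k + m - 1) (k + ℓ - 1) : ℝ) *
      (((k : ℝ) + (m : ℝ) - 2) / 2) ^ ℓ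

end

/-!
The theorem is the case `x = 1/2` of an expansion of `((arcsin x / x)²) ^ α`, as
`arcsin (1/2) = π/6`. Write `(arcsin x / x)² = 1 + g(t)` with `t = x²`. The coefficients of `g` are
nonnegative, so as long as `g(t) < 1` the double series obtained by inserting `g` into the binomial
series `∑ⱼ (α choose j) gʲ` converges absolutely and may be summed by powers of `t`.

The coefficients of `gʲ` come from those of `arcsin^(2ℓ) x`. With `x = sin θ`, the second derivative
in `θ` yields a recurrence for these, which is that of the polynomials `∏ (X - i²)`. On the other
side, `Q(2ℓ, 2n)` is a Taylor coefficient of a falling factorial with an odd number of factors about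
its centre of symmetry, where it equals `X ∏ (X² - i²)`.

The expansion of `θ²` itself is obtained without differentiating a series: the second derivatives
of the terms `aₙ sin^(2n+2) θ` telescope, and integrating twice bounds the remainder.
-/

section CentralFactorial

open Polynomial

variable {R : Type*} [CommRing R]

theorem signedStirlingFirst_succ_zero (n : ℕ) : signedStirlingFirst (n + 1) 0 = 0 := by
  simp [signedStirlingFirst]

theorem signedStirlingFirst_succ_succ (n k : ℕ) :
    signedStirlingFirst (n + 1) (k + 1) =
      signedStirlingFirst n k - n * signedStirlingFirst n (k + 1) := by
  simp only [signedStirlingFirst, Nat.stirlingFirst_succ_succ, Nat.add_sub_add_right]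
  rcases le_or_gt n k with h | h
  · simp [Nat.stirlingFirst_eq_zero_of_lt (Nat.lt_succ_of_le h)]
  · obtain ⟨d, rfl⟩ := Nat.exists_eq_add_of_lt h
    rw [show k + d + 1 - k = d + 1 by omega, show k + d + 1 - (k + 1) = d by omega]
    push_cast
    ring

theorem coeff_descPochhammer (n k : ℕ) :
    (descPochhammer R n).coeff k = (signedStirlingFirst n k : R) := by
  induction n generalizing k with
  | zero => cases k <;> simp [signedStirlingFirst, coeff_one]
  | succ n ih =>
    rw [descPochhammer_succ_right, mul_sub, coeff_sub, ← C_eq_natCast, coeff_mul_C]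
    cases k with
    | zero =>
      rw [coeff_mul_X_zero, ih, signedStirlingFirst_succ_zero]
      cases n <;> simp [signedStirlingFirst]
    | succ k =>
      rw [coeff_mul_X, ih, ih, signedStirlingFirst_succ_succ]
      push_cast
      ring

theorem stirlingQ_succ_eq_coeff_taylor (k m : ℕ) :
    stirlingQ (k + 1) m = (taylor (((k : ℝ) + m - 1) / 2) (descPochhammer ℝ (k + m))).coeff k := by
  have hdeg : (hasseDeriv k (descPochhammer ℝ (k + m))).natDegree < m + 1 := by
    have := natDegree_hasseDeriv_le (descPochhammer ℝ (k + m)) k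
    rw [descPochhammer_natDegree] at this
    omega
  rw [taylor_coeff, eval_eq_sum_range' hdeg, stirlingQ]
  refine Finset.sum_congr rfl fun i _ => ?_
  rw [hasseDeriv_coeff, coeff_descPochhammer, Nat.add_sub_cancel, Nat.add_right_comm k 1 i,
    Nat.add_right_comm k 1 m, Nat.add_sub_cancel, Nat.add_sub_cancel, add_comm i k]
  push_cast
  ring

variable (R) in
/-- The polynomial `∏ i < N, (X - i²)`. Its coefficients are the central factorial numbers of the
first kind with even indices; they link the numbers `stirlingQ` to the powers of `arcsin²`. -/
noncomputable def centralFactorial (N : ℕ) : R[X] :=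
  ∏ i ∈ Finset.range N, (X - C ((i : R) ^ 2))

theorem centralFactorial_succ (N : ℕ) :
    centralFactorial R (N + 1) = centralFactorial R N * (X - C ((N : R) ^ 2)) :=
  Finset.prod_range_succ _ _

theorem coeff_centralFactorial_succ_succ (N k : ℕ) :
    (centralFactorial R (N + 1)).coeff (k + 1) =
      (centralFactorial R N).coeff k - (N : R) ^ 2 * (centralFactorial R N).coeff (k + 1) := by
  rw [centralFactorial_succ, mul_sub, coeff_sub, coeff_mul_X, coeff_mul_C, mul_comm ((N : R) ^ 2)]

theorem coeff_centralFactorial_succ_zero (N : ℕ) : (centralFactorial R (N + 1)).coeff 0 = 0 := by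
  simp [centralFactorial, Finset.prod_range_succ', coeff_zero_eq_eval_zero]

theorem X_mul_taylor_descPochhammer (N : ℕ) :
    X * taylor (N : R) (descPochhammer R (2 * N + 1)) =
      (centralFactorial R (N + 1)).comp (X ^ 2) := by
  simp only [taylor_apply]
  induction N with
  | zero => simp [centralFactorial, sq, descPochhammer_one]
  | succ N ih =>
    have shift : (X + C ((N + 1 : ℕ) : R) - 1 : R[X]) = X + C (N : R) := by
      rw [Nat.cast_add, Nat.cast_one, C_add, C_1]
      ring
    rw [centralFactorial_succ, mul_comp, ← ih, show 2 * (N + 1) + 1 = 2 * N + 1 + 1 + 1 by ring,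
      descPochhammer_succ_left, descPochhammer_succ_right]
    simp only [mul_comp, comp_assoc, sub_comp, X_comp, C_comp, one_comp, natCast_comp]
    rw [shift]
    simp only [map_pow, C_eq_natCast]
    push_cast
    ring

theorem stirlingQ_eq_coeff_centralFactorial {ℓ : ℕ} (hℓ : ℓ ≠ 0) (n : ℕ) :
    stirlingQ (2 * ℓ) (2 * n) = (centralFactorial ℝ (ℓ + n)).coeff ℓ := by
  obtain ⟨k, rfl⟩ := Nat.exists_eq_succ_of_ne_zero hℓ
  have center : (((2 * k + 1 : ℕ) : ℝ) + (2 * n : ℕ) - 1) / 2 = (k + n : ℕ) := by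
    push_cast
    ring
  have h := congrArg (coeff · (2 * k + 1 + 1)) (X_mul_taylor_descPochhammer (R := ℝ) (k + n))
  rw [coeff_X_mul, show 2 * k + 1 + 1 = (k + 1) * 2 by ring, ← expand_eq_comp_X_pow,
    coeff_expand_mul two_pos] at h
  rw [show 2 * (k + 1) = 2 * k + 1 + 1 by ring, stirlingQ_succ_eq_coeff_taylor, center,
    show 2 * k + 1 + 2 * n = 2 * (k + n) + 1 by ring, h, Nat.succ_add]

end CentralFactorial

section FormalArcsin

open PowerSeries

variable {R : Type*} [CommRing R]

/-- The operator `d²/dθ²`, equivalently `(1 - x²) d²/dx² - x d/dx` with `x = sin θ`, acting on power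
series in the variable `t = x²`. It sends the series of `θ ^ (2k + 2)`, the powers of `arcsin² x`,
to `(2k + 2)(2k + 1)` times the series of `θ ^ (2k)`. -/
noncomputable def sinSqLaplacian (f : R⟦X⟧) : R⟦X⟧ :=
  2 * (2 * (X * d⁄dX R (d⁄dX R f)) + d⁄dX R f) - 4 * (X * d⁄dX R (X * d⁄dX R f))

theorem coeff_X_mul_derivative (f : R⟦X⟧) (n : ℕ) :
    coeff n (X * d⁄dX R f) = n * coeff n f := by
  cases n with
  | zero => simp
  | succ n => rw [coeff_succ_X_mul, coeff_derivative, mul_comm, Nat.cast_succ]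

theorem coeff_sinSqLaplacian (f : R⟦X⟧) (m : ℕ) :
    coeff m (sinSqLaplacian f) =
      (2 * m + 2) * (2 * m + 1) * coeff (m + 1) f - 4 * (m : R) ^ 2 * coeff m f := by
  have two : (2 : R⟦X⟧) = C 2 := (map_ofNat C 2).symm
  have four : (4 : R⟦X⟧) = C 4 := (map_ofNat C 4).symm
  simp only [sinSqLaplacian, two, four, map_add, map_sub, coeff_C_mul, coeff_X_mul_derivative,
    coeff_derivative]
  ring

theorem sinSqLaplacian_pow (f : R⟦X⟧) (k : ℕ) :
    sinSqLaplacian (f ^ (k + 2)) = ((k : R⟦X⟧) + 2) * f ^ (k + 1) * sinSqLaplacian f +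
      4 * ((k : R⟦X⟧) + 2) * ((k : R⟦X⟧) + 1) * f ^ k * (X * (1 - X) * (d⁄dX R f) ^ 2) := by
  simp only [sinSqLaplacian, Derivation.leibniz, derivative_pow, derivative_X, smul_eq_mul,
    Derivation.map_natCast, Nat.add_sub_cancel, show k + 2 - 1 = k + 1 from rfl]
  push_cast
  ring

/-- The power series `∑ 4ⁿ⁺¹ / (2 (n + 1)² C(2n + 2, n + 1)) tⁿ`, which is `(arcsin x / x)²` in the
variable `t = x²`; thus `X * arcsinDivSq` is the series of `arcsin² x`. -/
noncomputable def arcsinDivSq : ℝ⟦X⟧ :=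
  mk fun n => 4 ^ (n + 1) / (2 * (n + 1) ^ 2 * (n + 1).centralBinom)

theorem coeff_arcsinDivSq (n : ℕ) :
    coeff n arcsinDivSq = 4 ^ (n + 1) / (2 * (n + 1) ^ 2 * (n + 1).centralBinom) :=
  coeff_mk _ _

theorem coeff_arcsinDivSq_nonneg (n : ℕ) : 0 ≤ coeff n arcsinDivSq := by
  rw [coeff_arcsinDivSq]
  positivity

theorem constantCoeff_arcsinDivSq : constantCoeff arcsinDivSq = 1 := by
  rw [← coeff_zero_eq_constantCoeff_apply, coeff_arcsinDivSq]
  norm_num [Nat.centralBinom]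

theorem four_mul_sq_mul_coeff_arcsinDivSq (n : ℕ) :
    4 * (n + 1) ^ 2 * coeff n arcsinDivSq = 2 * 4 ^ (n + 1) / (n + 1).centralBinom := by
  have := (n + 1).centralBinom_ne_zero
  rw [coeff_arcsinDivSq]
  field_simp
  ring

theorem mul_coeff_arcsinDivSq (n : ℕ) :
    (2 * n + 2) * (2 * n + 1) * coeff n arcsinDivSq = 2 * 4 ^ n / n.centralBinom := by
  have hsucc : ((n + 1 : ℝ)) * (n + 1).centralBinom = 2 * (2 * n + 1) * n.centralBinom :=
    mod_cast n.succ_mul_centralBinom_succ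
  have := n.centralBinom_ne_zero
  have := (n + 1).centralBinom_ne_zero
  rw [coeff_arcsinDivSq]
  field_simp
  linear_combination (-2 * 4 ^ n : ℝ) * hsucc

theorem sinSqLaplacian_X_mul_arcsinDivSq : sinSqLaplacian (X * arcsinDivSq) = 2 := by
  ext m
  rw [coeff_sinSqLaplacian, coeff_succ_X_mul, mul_coeff_arcsinDivSq, ← map_ofNat C 2, coeff_C]
  cases m with
  | zero => simp
  | succ m =>
    rw [coeff_succ_X_mul, if_neg m.succ_ne_zero, Nat.cast_succ, four_mul_sq_mul_coeff_arcsinDivSq,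
      sub_self]

theorem mul_derivative_X_mul_arcsinDivSq_sq :
    X * (1 - X) * (d⁄dX ℝ (X * arcsinDivSq)) ^ 2 = X * arcsinDivSq := by
  have h := sinSqLaplacian_X_mul_arcsinDivSq
  set u := X * arcsinDivSq with hu
  have two_ne_zero : (2 : ℝ⟦X⟧) ≠ 0 := by
    rw [← map_ofNat C 2, map_ne_zero_iff C C_injective]
    exact two_ne_zero
  apply derivative.ext
  · apply mul_left_cancel₀ two_ne_zero
    simp only [sinSqLaplacian, Derivation.leibniz, derivative_pow, map_sub, derivative_X,
      derivative_one, smul_eq_mul] at h ⊢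
    push_cast
    linear_combination d⁄dX ℝ u * h
  · simp [hu]

theorem sinSqLaplacian_X_mul_arcsinDivSq_pow (k : ℕ) :
    sinSqLaplacian ((X * arcsinDivSq) ^ (k + 1)) =
      C ((2 * k + 2) * (2 * k + 1) : ℝ) * (X * arcsinDivSq) ^ k := by
  cases k with
  | zero => simp [sinSqLaplacian_X_mul_arcsinDivSq, ← map_ofNat C 2]
  | succ k =>
    rw [sinSqLaplacian_pow, sinSqLaplacian_X_mul_arcsinDivSq, mul_derivative_X_mul_arcsinDivSq_sq]
    simp only [map_mul, map_add, map_ofNat, map_natCast, map_one]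
    push_cast
    ring

theorem factorial_mul_coeff_X_mul_arcsinDivSq_pow (N ℓ : ℕ) :
    ((2 * N).factorial : ℝ) * (-4) ^ ℓ * coeff N ((X * arcsinDivSq) ^ ℓ) =
      (-4) ^ N * (2 * ℓ).factorial * (centralFactorial ℝ N).coeff ℓ := by
  have factorial_step (n : ℕ) : ((2 * (n + 1)).factorial : ℝ) =
      (2 * n + 2) * (2 * n + 1) * (2 * n).factorial := by
    rw [show 2 * (n + 1) = 2 * n + 1 + 1 by ring, Nat.factorial_succ, Nat.factorial_succ]
    push_cast
    ring
  induction N generalizing ℓ with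
  | zero => cases ℓ <;> simp [centralFactorial, Polynomial.coeff_one]
  | succ N ih =>
    cases ℓ with
    | zero => simp [coeff_centralFactorial_succ_zero, coeff_one]
    | succ k =>
      have recurrence := congrArg (coeff N) (sinSqLaplacian_X_mul_arcsinDivSq_pow k)
      rw [coeff_sinSqLaplacian, coeff_C_mul] at recurrence
      have ih_succ := ih (k + 1)
      rw [factorial_step k] at ih_succ ⊢
      rw [coeff_centralFactorial_succ_succ, factorial_step N]
      linear_combination ((2 * N).factorial : ℝ) * (-4) ^ (k + 1) * recurrence +
        4 * (N : ℝ) ^ 2 * ih_succ - 4 * (2 * k + 2 : ℝ) * (2 * k + 1) * ih k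

theorem coeff_arcsinDivSq_pow {ℓ : ℕ} (hℓ : ℓ ≠ 0) (n : ℕ) :
    coeff n (arcsinDivSq ^ ℓ) = (-4) ^ n * ((2 * ℓ).factorial *
      (stirlingQ (2 * ℓ) (2 * n) / (2 * ℓ + 2 * n).factorial)) := by
  have h := factorial_mul_coeff_X_mul_arcsinDivSq_pow (ℓ + n) ℓ
  rw [mul_pow, add_comm ℓ n, coeff_X_pow_mul, add_comm n ℓ,
    ← stirlingQ_eq_coeff_centralFactorial hℓ, mul_add, pow_add] at h
  rw [← mul_div_assoc, ← mul_div_assoc, eq_div_iff (by positivity)]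
  apply mul_left_cancel₀ (pow_ne_zero ℓ (by norm_num : (-4 : ℝ) ≠ 0))
  linear_combination h

theorem coeff_sub_one_pow (f : R⟦X⟧) {n : ℕ} (hn : n ≠ 0) (j : ℕ) :
    coeff n ((f - 1) ^ j) =
      (-1) ^ j * ∑ ℓ ∈ Finset.Icc 1 j, (-1) ^ ℓ * j.choose ℓ * coeff n (f ^ ℓ) := by
  have hterm (ℓ : ℕ) : coeff n ((-1) ^ (ℓ + j) * f ^ ℓ * 1 ^ (j - ℓ) * (j.choose ℓ : R⟦X⟧)) =
      (-1) ^ j * ((-1) ^ ℓ * j.choose ℓ * coeff n (f ^ ℓ)) := by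
    rw [one_pow, mul_one, ← map_natCast (C (R := R)), coeff_mul_C, pow_add,
      show ((-1) ^ ℓ * (-1) ^ j : R⟦X⟧) = C ((-1) ^ ℓ * (-1) ^ j) by simp, coeff_C_mul]
    ring
  rw [sub_pow, map_sum, Finset.sum_congr rfl fun ℓ _ => hterm ℓ, ← Finset.mul_sum,
    Finset.range_eq_Ico, Finset.sum_eq_sum_Ico_succ_bot j.succ_pos, pow_zero f, coeff_one,
    if_neg hn, mul_zero, zero_add]
  rfl

theorem coeff_arcsinDivSq_sub_one_pow {n : ℕ} (hn : n ≠ 0) (j : ℕ) :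
    coeff n ((arcsinDivSq - 1) ^ j) = (-4) ^ n * ((-1) ^ j * ∑ ℓ ∈ Finset.Icc 1 j,
      (-1) ^ ℓ * (2 * ℓ).factorial * j.choose ℓ *
        (stirlingQ (2 * ℓ) (2 * n) / (2 * ℓ + 2 * n).factorial)) := by
  rw [coeff_sub_one_pow _ hn, mul_left_comm, Finset.mul_sum _ _ ((-4) ^ n)]
  congr 1
  refine Finset.sum_congr rfl fun ℓ hℓ => ?_
  rw [coeff_arcsinDivSq_pow (Nat.one_le_iff_ne_zero.1 (Finset.mem_Icc.1 hℓ).1)]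
  ring

end FormalArcsin

section ArcsinSeries

open PowerSeries Real Filter Topology

theorem norm_le_mul_sq_of_norm_deriv_deriv_le {𝕜 E : Type*} [RCLike 𝕜] [NormedAddCommGroup E]
    [NormedSpace 𝕜 E] {f f' f'' : 𝕜 → E} {C : ℝ} {x : 𝕜}
    (hf : ∀ y, HasDerivAt f (f' y) y) (hf' : ∀ y, HasDerivAt f' (f'' y) y)
    (hf0 : f 0 = 0) (hf'0 : f' 0 = 0) (bound : ∀ y, ‖y‖ ≤ ‖x‖ → ‖f'' y‖ ≤ C) :
    ‖f x‖ ≤ C * ‖x‖ ^ 2 := by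
  have mean_value {g g' : 𝕜 → E} {B : ℝ} (hg : ∀ y, HasDerivAt g (g' y) y) (hg0 : g 0 = 0)
      (hB : ∀ y, ‖y‖ ≤ ‖x‖ → ‖g' y‖ ≤ B) {y : 𝕜} (hy : ‖y‖ ≤ ‖x‖) : ‖g y‖ ≤ B * ‖y‖ := by
    let := NormedSpace.restrictScalars ℝ 𝕜 E
    have := (convex_closedBall (0 : 𝕜) ‖x‖).norm_image_sub_le_of_norm_hasDerivWithin_le
      (fun z _ => (hg z).hasDerivWithinAt) (fun z hz => hB z (mem_closedBall_zero_iff.1 hz))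
      (mem_closedBall_zero_iff.2 (norm_zero.trans_le (norm_nonneg x)))
      (mem_closedBall_zero_iff.2 hy)
    rwa [hg0, sub_zero, sub_zero] at this
  have hC : 0 ≤ C := (norm_nonneg _).trans (bound x le_rfl)
  refine (mean_value (B := C * ‖x‖) hf hf0 (fun y hy => ?_) le_rfl).trans_eq (by ring)
  exact (mean_value hf' hf'0 bound hy).trans (mul_le_mul_of_nonneg_left hy hC)

theorem hasDerivAt_sum_mul_sin_pow (c : ℕ → ℝ) (N : ℕ) (θ : ℝ) :
    HasDerivAt (fun φ => ∑ n ∈ Finset.range N, c n * sin φ ^ (2 * n + 2))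
      (∑ n ∈ Finset.range N, c n * ((2 * n + 2) * (sin θ ^ (2 * n + 1) * cos θ))) θ := by
  refine HasDerivAt.fun_sum fun n _ => (((hasDerivAt_sin θ).fun_pow _).const_mul _).congr_deriv ?_
  push_cast
  ring

theorem hasDerivAt_sum_mul_sin_pow_mul_cos (c : ℕ → ℝ) (N : ℕ) (θ : ℝ) :
    HasDerivAt
      (fun φ => ∑ n ∈ Finset.range N, c n * ((2 * n + 2) * (sin φ ^ (2 * n + 1) * cos φ)))
      (∑ n ∈ Finset.range N, ((2 * n + 2) * (2 * n + 1) * c n * sin θ ^ (2 * n) -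
        4 * (n + 1) ^ 2 * c n * sin θ ^ (2 * (n + 1)))) θ := by
  refine HasDerivAt.fun_sum fun n _ =>
    (((((hasDerivAt_sin θ).fun_pow _).fun_mul (hasDerivAt_cos θ)).const_mul _).const_mul
      _).congr_deriv ?_
  push_cast
  linear_combination (c n * (2 * n + 2) * (2 * n + 1) * sin θ ^ (2 * n)) * sin_sq_add_cos_sq θ

theorem tendsto_four_pow_div_centralBinom_mul_pow {q : ℝ} (h0 : 0 ≤ q) (h1 : q < 1) :
    Tendsto (fun n : ℕ => 2 * 4 ^ n / n.centralBinom * q ^ n) atTop (𝓝 0) := by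
  have hlim := (tendsto_self_mul_const_pow_of_lt_one h0 h1).const_mul 4
  rw [mul_zero] at hlim
  refine squeeze_zero' (.of_forall fun n => by positivity) ?_ hlim
  filter_upwards [eventually_gt_atTop 0] with n hn
  have hcentral : (4 : ℝ) ^ n ≤ 2 * n * n.centralBinom :=
    mod_cast Nat.four_pow_le_two_mul_self_mul_centralBinom n hn
  have hpos : (0 : ℝ) < n.centralBinom := mod_cast n.centralBinom_pos
  rw [← mul_assoc]
  gcongr
  rw [div_le_iff₀ hpos]
  linarith

theorem abs_sq_sub_sum_arcsinDivSq_le {θ : ℝ} (hθ : |θ| < π / 2) (N : ℕ) :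
    |θ ^ 2 - ∑ n ∈ Finset.range N, coeff n arcsinDivSq * sin θ ^ (2 * n + 2)| ≤
      2 * 4 ^ N / N.centralBinom * (sin θ ^ 2) ^ N * |θ| ^ 2 := by
  refine norm_le_mul_sq_of_norm_deriv_deriv_le
    (f' := fun φ => 2 * φ - ∑ n ∈ Finset.range N,
      coeff n arcsinDivSq * ((2 * n + 2) * (sin φ ^ (2 * n + 1) * cos φ)))
    (f'' := fun φ => 2 * 4 ^ N / N.centralBinom * sin φ ^ (2 * N))
    (fun φ => ((hasDerivAt_pow 2 φ).sub (hasDerivAt_sum_mul_sin_pow _ N φ)).congr_deriv (by simp))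
    (fun φ => (((hasDerivAt_id φ).const_mul 2).sub
      (hasDerivAt_sum_mul_sin_pow_mul_cos _ N φ)).congr_deriv ?_) (by simp) (by simp)
    fun φ hφ => ?_
  · have htel := Finset.sum_range_sub'
      (fun n : ℕ => 2 * 4 ^ n / (n.centralBinom : ℝ) * sin φ ^ (2 * n)) N
    simp only [mul_coeff_arcsinDivSq, four_mul_sq_mul_coeff_arcsinDivSq, htel]
    simp
  · rw [norm_eq_abs, norm_eq_abs] at hφ
    have hcos : cos θ ≤ cos φ := by
      rw [← cos_abs θ, ← cos_abs φ]
      exact cos_le_cos_of_nonneg_of_le_pi (abs_nonneg φ) (by linarith [pi_pos]) hφ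
    have hsin : sin φ ^ 2 ≤ sin θ ^ 2 := by
      rw [sin_sq, sin_sq]
      gcongr
      exact (cos_pos_of_mem_Ioo (abs_lt.1 hθ)).le
    rw [pow_mul, norm_of_nonneg (by positivity)]
    gcongr

theorem hasSum_arcsinDivSq_mul_sin_pow {θ : ℝ} (hθ : |θ| < π / 2) :
    HasSum (fun n => coeff n arcsinDivSq * sin θ ^ (2 * n + 2)) (θ ^ 2) := by
  have hsin : sin θ ^ 2 < 1 := by
    rw [sin_sq]
    linarith [pow_pos (cos_pos_of_mem_Ioo (abs_lt.1 hθ)) 2]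
  rw [hasSum_iff_tendsto_nat_of_nonneg fun n => mul_nonneg (coeff_arcsinDivSq_nonneg n)
    (Even.pow_nonneg ⟨n + 1, by ring⟩ _)]
  have hlim := (tendsto_four_pow_div_centralBinom_mul_pow (sq_nonneg (sin θ)) hsin).mul_const
    (|θ| ^ 2)
  rw [zero_mul] at hlim
  rw [tendsto_iff_dist_tendsto_zero]
  refine squeeze_zero (fun _ => dist_nonneg) (fun N => ?_) hlim
  rw [dist_comm]
  exact abs_sq_sub_sum_arcsinDivSq_le hθ N

theorem hasSum_arcsinDivSq {x : ℝ} (hx0 : x ≠ 0) (hx : |x| < 1) :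
    HasSum (fun n => coeff n arcsinDivSq * (x ^ 2) ^ n) ((arcsin x / x) ^ 2) := by
  obtain ⟨hlb, hub⟩ := abs_lt.1 hx
  have h := hasSum_arcsinDivSq_mul_sin_pow
    (abs_lt.2 ⟨neg_pi_div_two_lt_arcsin.2 hlb, arcsin_lt_pi_div_two.2 hub⟩)
  rw [sin_arcsin hlb.le hub.le] at h
  rw [div_pow]
  refine (h.div_const (x ^ 2)).congr_fun fun n => ?_
  field_simp
  ring

end ArcsinSeries

section Composition

open PowerSeries

variable {R : Type*} [NormedCommRing R]

theorem summable_norm_coeff_mul {f g : R⟦X⟧} (hf : Summable fun n => ‖coeff n f‖)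
    (hg : Summable fun n => ‖coeff n g‖) : Summable fun n => ‖coeff n (f * g)‖ := by
  simpa only [coeff_mul] using summable_norm_sum_mul_antidiagonal_of_summable_norm hf hg

theorem tsum_norm_coeff_mul_le {f g : R⟦X⟧} (hf : Summable fun n => ‖coeff n f‖)
    (hg : Summable fun n => ‖coeff n g‖) :
    ∑' n, ‖coeff n (f * g)‖ ≤ (∑' n, ‖coeff n f‖) * ∑' n, ‖coeff n g‖ := by
  rw [tsum_mul_tsum_eq_tsum_sum_antidiagonal_of_summable_norm hf.norm hg.norm]
  refine (summable_norm_coeff_mul hf hg).tsum_le_tsum (fun n => ?_)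
    (summable_norm_sum_mul_antidiagonal_of_summable_norm hf.norm hg.norm).of_norm
  rw [coeff_mul]
  exact norm_sum_le_of_le _ fun p _ => norm_mul_le _ _

theorem summable_norm_coeff_pow {g : R⟦X⟧} (hg : Summable fun n => ‖coeff n g‖) (j : ℕ) :
    Summable fun n => ‖coeff n (g ^ j)‖ := by
  induction j with
  | zero => exact summable_of_ne_finset_zero (s := {0}) fun n hn => by simp_all [coeff_one]
  | succ j ih => exact pow_succ g j ▸ summable_norm_coeff_mul ih hg

theorem tsum_coeff_pow [CompleteSpace R] {g : R⟦X⟧} (hg : Summable fun n => ‖coeff n g‖) (j : ℕ) :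
    ∑' n, coeff n (g ^ j) = (∑' n, coeff n g) ^ j := by
  induction j with
  | zero => simp [coeff_one]
  | succ j ih =>
    rw [pow_succ (∑' n, coeff n g), ← ih,
      tsum_mul_tsum_eq_tsum_sum_antidiagonal_of_summable_norm (summable_norm_coeff_pow hg j) hg]
    simp only [pow_succ, coeff_mul]

variable [NormOneClass R]

theorem tsum_norm_coeff_pow_le {g : R⟦X⟧} (hg : Summable fun n => ‖coeff n g‖) (j : ℕ) :
    ∑' n, ‖coeff n (g ^ j)‖ ≤ (∑' n, ‖coeff n g‖) ^ j := by
  induction j with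
  | zero => simp [coeff_one, apply_ite norm]
  | succ j ih =>
    rw [pow_succ, pow_succ]
    refine (tsum_norm_coeff_mul_le (summable_norm_coeff_pow hg j) hg).trans ?_
    gcongr

theorem hasSum_sum_mul_coeff_pow [CompleteSpace R] {g : R⟦X⟧} (hg0 : constantCoeff g = 0)
    (hg : Summable fun n => ‖coeff n g‖) {c : ℕ → R}
    (hc : Summable fun j => ‖c j‖ * (∑' n, ‖coeff n g‖) ^ j) :
    HasSum (fun n => ∑ j ∈ Finset.range (n + 1), c j * coeff n (g ^ j))
      (∑' j, c j * (∑' n, coeff n g) ^ j) := by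
  have hrow (j : ℕ) : Summable fun n => ‖c j‖ * ‖coeff n (g ^ j)‖ :=
    (summable_norm_coeff_pow hg j).mul_left _
  have hdouble : Summable fun p : ℕ × ℕ => c p.1 * coeff p.2 (g ^ p.1) := by
    refine Summable.of_norm_bounded (g := fun p => ‖c p.1‖ * ‖coeff p.2 (g ^ p.1)‖) ?_
      fun p => norm_mul_le _ _
    rw [summable_prod_of_nonneg fun p => by positivity]
    refine ⟨hrow, hc.of_nonneg_of_le (fun j => tsum_nonneg fun n => by positivity) fun j => ?_⟩
    dsimp only
    rw [tsum_mul_left]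
    gcongr
    exact tsum_norm_coeff_pow_le hg j
  have htotal : ∑' p : ℕ × ℕ, c p.1 * coeff p.2 (g ^ p.1) = ∑' j, c j * (∑' n, coeff n g) ^ j := by
    rw [hdouble.tsum_prod]
    refine tsum_congr fun j => ?_
    dsimp only
    rw [(summable_norm_coeff_pow hg j).of_norm.tsum_mul_left, tsum_coeff_pow hg]
  rw [← htotal]
  refine ((Equiv.prodComm ℕ ℕ).hasSum_iff.2 hdouble.hasSum).prod_fiberwise fun n => ?_
  refine hasSum_sum_of_ne_finset_zero fun j hj => ?_
  have hlt : (n : ℕ∞) < j := mod_cast (by simpa using hj : n < j)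
  simp [coeff_of_lt_order n (hlt.trans_le (le_order_pow_of_constantCoeff_eq_zero j hg0))]

theorem hasSum_choose_mul_pow (α : ℝ) {s : ℝ} (hs : |s| < 1) :
    HasSum (fun j => Ring.choose α j * s ^ j) ((1 + s) ^ α) := by
  have h := (Real.one_add_rpow_hasFPowerSeriesOnBall_zero (a := α)).hasSum (y := s)
    (by simpa [enorm_eq_nnnorm, ← NNReal.coe_lt_coe] using hs)
  simpa [-FormalMultilinearSeries.apply_eq_prod_smul_coeff, mul_comm] using h

theorem hasSum_sum_choose_mul_coeff_pow {g : ℝ⟦X⟧} (hg0 : constantCoeff g = 0)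
    (hg : Summable fun n => ‖coeff n g‖) (hg1 : ∑' n, ‖coeff n g‖ < 1) (α : ℝ) :
    HasSum (fun n => ∑ j ∈ Finset.range (n + 1), Ring.choose α j * coeff n (g ^ j))
      ((1 + ∑' n, coeff n g) ^ α) := by
  have hnonneg : 0 ≤ ∑' n, ‖coeff n g‖ := tsum_nonneg fun n => norm_nonneg _
  have habs : |∑' n, coeff n g| < 1 := (norm_tsum_le_tsum_norm hg).trans_lt hg1
  rw [← (hasSum_choose_mul_pow α habs).tsum_eq]
  refine hasSum_sum_mul_coeff_pow hg0 hg ?_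
  have h := (hasSum_choose_mul_pow α ((abs_of_nonneg hnonneg).trans_lt hg1)).summable.norm
  simpa only [norm_mul, norm_pow, Real.norm_of_nonneg hnonneg] using h

end Composition

section ArcsinPowers

open PowerSeries Real

theorem choose_eq_fallingFactorial_div (α : ℝ) (j : ℕ) :
    Ring.choose α j = fallingFactorial α j / j.factorial := by
  rw [Ring.choose_eq_smul, fallingFactorial, ← descPochhammer_eval_eq_prod_range,
    Polynomial.descPochhammer_smeval_eq_ascPochhammer, Polynomial.ascPochhammer_smeval_cast,
    Polynomial.ascPochhammer_smeval_eq_eval, ← descPochhammer_eval_eq_ascPochhammer, smul_eq_mul,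
    inv_mul_eq_div]

theorem hasSum_arcsin_div_sq_rpow {x : ℝ} (hx : |x| < 1) (hx' : arcsin x ^ 2 < 2 * x ^ 2) (α : ℝ) :
    HasSum (fun n => ∑ j ∈ Finset.range (n + 1),
        Ring.choose α j * ((x ^ 2) ^ n * coeff n ((arcsinDivSq - 1) ^ j)))
      (((arcsin x / x) ^ 2) ^ α) := by
  have hx0 : x ≠ 0 := by
    rintro rfl
    simp at hx'
  set g : ℝ⟦X⟧ := rescale (x ^ 2) (arcsinDivSq - 1) with hg
  have hcoeff (n : ℕ) : coeff n g = coeff n arcsinDivSq * (x ^ 2) ^ n - if n = 0 then 1 else 0 := by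
    rw [hg, coeff_rescale, map_sub, coeff_one]
    split_ifs with h <;> simp [h, mul_comm]
  have hconst : constantCoeff g = 0 := by
    rw [← coeff_zero_eq_constantCoeff_apply, hcoeff]
    simp [constantCoeff_arcsinDivSq]
  have hnorm (n : ℕ) : ‖coeff n g‖ = coeff n g := by
    refine norm_of_nonneg ?_
    rcases eq_or_ne n 0 with rfl | hn
    · rw [coeff_zero_eq_constantCoeff_apply, hconst]
    · rw [hcoeff, if_neg hn, sub_zero]
      exact mul_nonneg (coeff_arcsinDivSq_nonneg n) (by positivity)
  have hsum : HasSum (fun n => coeff n g) ((arcsin x / x) ^ 2 - 1) := by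
    simpa only [hcoeff] using (hasSum_arcsinDivSq hx0 hx).sub (hasSum_ite_eq 0 1)
  have hlt : (arcsin x / x) ^ 2 - 1 < 1 := by
    rw [div_pow, sub_lt_iff_lt_add, div_lt_iff₀ (by positivity)]
    linarith
  have h := hasSum_sum_choose_mul_coeff_pow hconst (by simpa only [hnorm] using hsum.summable)
    (by simpa only [hnorm, hsum.tsum_eq] using hlt) α
  rw [hsum.tsum_eq, add_sub_cancel] at h
  simpa only [hg, ← map_pow, coeff_rescale] using h

theorem corollary5p2_general {x : ℝ} (hx : |x| < 1) (hx' : arcsin x ^ 2 < 2 * x ^ 2) (α : ℝ) :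
    HasSum
      (fun n : ℕ+ =>
        (-1 : ℝ) ^ (n : ℕ) *
          (∑ j ∈ Finset.Icc 1 (n : ℕ),
            (-1 : ℝ) ^ j * (fallingFactorial α j / (Nat.factorial j : ℝ)) *
              ∑ ℓ ∈ Finset.Icc 1 j,
                (-1 : ℝ) ^ ℓ * (Nat.factorial (2 * ℓ) : ℝ) * (Nat.choose j ℓ : ℝ) *
                  (stirlingQ (2 * ℓ) (2 * (n : ℕ)) /
                    (Nat.factorial (2 * ℓ + 2 * (n : ℕ)) : ℝ))) *
          (2 * x) ^ (2 * (n : ℕ)))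
      (((arcsin x / x) ^ 2) ^ α - 1) := by
  have h := hasSum_arcsin_div_sq_rpow hx hx' α
  rw [← sub_add_cancel (((arcsin x / x) ^ 2) ^ α) 1] at h
  refine (hasSum_pnat_iff (f := fun n => ∑ j ∈ Finset.range (n + 1),
    Ring.choose α j * ((x ^ 2) ^ n * coeff n ((arcsinDivSq - 1) ^ j))) |>.2
      (by simpa using h)).congr_fun fun n => ?_
  rw [Finset.range_eq_Ico, Finset.sum_eq_sum_Ico_succ_bot (by lia), pow_zero, coeff_one,
    if_neg n.ne_zero, mul_zero, mul_zero, zero_add, Finset.mul_sum, Finset.sum_mul]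
  have hscale : (2 * x) ^ (2 * (n : ℕ)) = 4 ^ (n : ℕ) * (x ^ 2) ^ (n : ℕ) := by
    rw [pow_mul, ← mul_pow]
    ring
  refine Finset.sum_congr rfl fun j _ => ?_
  rw [coeff_arcsinDivSq_sub_one_pow n.ne_zero, choose_eq_fallingFactorial_div, hscale,
    neg_pow (4 : ℝ)]
  ring

end ArcsinPowers

theorem corollary5p2 (α : ℝ) :
    HasSum
      (fun n : ℕ+ =>
        (-1 : ℝ) ^ (n : ℕ) *
          ∑ j ∈ Finset.Icc 1 (n : ℕ),
            (-1 : ℝ) ^ j * (fallingFactorial α j / (Nat.factorial j : ℝ)) *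
              ∑ ℓ ∈ Finset.Icc 1 j,
                (-1 : ℝ) ^ ℓ * (Nat.factorial (2 * ℓ) : ℝ) * (Nat.choose j ℓ : ℝ) *
                  (stirlingQ (2 * ℓ) (2 * (n : ℕ)) /
                    (Nat.factorial (2 * ℓ + 2 * (n : ℕ)) : ℝ)))
      ((Real.pi ^ 2 / 9) ^ α - 1) := by
  have harcsin : Real.arcsin (1 / 2) = Real.pi / 6 := by
    rw [← Real.sin_pi_div_six]
    exact Real.arcsin_sin (by linarith [Real.pi_pos]) (by linarith [Real.pi_pos])
  have h := corollary5p2_general (x := 1 / 2) (by norm_num [abs_of_pos])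
    (by rw [harcsin]; nlinarith [Real.pi_pos, Real.pi_lt_four]) α
  have hbase : (Real.pi / 6 / (1 / 2)) ^ 2 = Real.pi ^ 2 / 9 := by ring
  simpa only [harcsin, hbase, mul_one_div_cancel (two_ne_zero (α := ℝ)), one_pow, mul_one] using h
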